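/- Let $V$ be a discrete valuation ring with quotient field $F$, let $K/F$ be a finite Galois extension with group $G$, and let $S$ be the integral closure of $V$ in $K$; assume that $S$ is unramified over $V$. Let $f : G\times G \to K\setminus\{0\}$ be a normalized two-cocycle with values in $S\setminus\{0\}$, let $\Sigma_f=\sum_{\sigma\in G}Kx_\sigma=(K/F,G,f)$ be the crossed-product $F$-algebra (with multiplication given by $x_\sigma k=\sigma(k)x_\sigma$ for $k \in K$ and $x_\sigma x_\tau=f(\sigma,\tau)x_{\sigma\tau}$), and let $A_f=\sum_{\sigma\in G}Sx_\sigma$, a $V$-order in $\Sigma_f$. For a maximal ideal $M$ of $S$ let $D_M=\{\sigma\in G : \sigma(M)=M\}$ be its decomposition group. Then: (1) $A_f$ is a maximal $V$-order in $\Sigma_f$ if and only if, for every maximal ideal $M$ of $S$, $f(\tau,\tau^{-1})\notin M^2$ for all $\tau\in G$, and there exists a set of right coset representatives $g_1,\dots,g_r$ of $D_M$ in $G$ (i.e., $G$ is the disjoint union $\bigcup_i D_Mg_i$) such that $f(g_i,g_i^{-1})\notin M$ for all $i$. (2) If $S$ is a discrete valuation ring, then $A_f$ is a maximal $V$-order in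 $\Sigma_f$ if and only if $f(\tau,\tau^{-1})\notin J(S)^2$ for all $\tau\in G$, where $J(S)$ is the Jacobson radical of $S$. -/

import Mathlib

open scoped Pointwise

/-- A normalized two-cocycle `f ∈ Z²(G, U(K))`, where `G = Gal(K/F)` acts naturally on `U(K)`. -/
structure NormalizedCocycle (F K : Type*) [Field F] [Field K] [Algebra F K] where
  /-- the underlying map `G × G → U(K)` -/
  toFun : Gal(K/F) × Gal(K/F) → Kˣ
  isMulCocycle : groupCohomology.IsMulCocycle₂ toFun
  map_one_left : ∀ σ, toFun (1, σ) = 1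
  map_one_right : ∀ σ, toFun (σ, 1) = 1

namespace NormalizedCocycle

variable {F K : Type*} [Field F] [Field K] [Algebra F K]

/-- The value `f(σ, τ)`, as an element of `K`. -/
def val (f : NormalizedCocycle F K) (σ τ : Gal(K/F)) : K := (f.toFun (σ, τ) : Kˣ)

theorem val_one_left (f : NormalizedCocycle F K) (σ : Gal(K/F)) : f.val 1 σ = 1 := by
  simp [val, f.map_one_left]

theorem val_one_right (f : NormalizedCocycle F K) (σ : Gal(K/F)) : f.val σ 1 = 1 := by
  simp [val, f.map_one_right]

theorem val_cocycle (f : NormalizedCocycle F K) (σ τ γ : Gal(K/F)) :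
    f.val (σ * τ) γ * f.val σ τ = σ (f.val τ γ) * f.val σ (τ * γ) := by
  have h := congrArg (fun u : Kˣ => (u : K)) (f.isMulCocycle σ τ γ)
  simpa [val] using h

end NormalizedCocycle

/-- The crossed-product algebra `Σ_f = ∑_{σ ∈ G} K x_σ = (K/F, G, f)`. The element `a` stands for
`∑_σ a.coeff σ • x_σ`. -/
@[ext]
structure CrossedProduct {F K : Type*} [Field F] [Field K] [Algebra F K]
    (f : NormalizedCocycle F K) where
  /-- the coefficient of `x_σ` -/
  coeff : Gal(K/F) → K

namespace CrossedProduct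

variable {F K : Type*} [Field F] [Field K] [Algebra F K] {f : NormalizedCocycle F K}

instance : Zero (CrossedProduct f) := ⟨⟨0⟩⟩
instance : Add (CrossedProduct f) := ⟨fun a b => ⟨a.coeff + b.coeff⟩⟩
instance : Neg (CrossedProduct f) := ⟨fun a => ⟨-a.coeff⟩⟩
instance : Sub (CrossedProduct f) := ⟨fun a b => ⟨a.coeff - b.coeff⟩⟩

instance {R : Type*} [SMul R K] : SMul R (CrossedProduct f) := ⟨fun r a => ⟨r • a.coeff⟩⟩

theorem coeff_injective :
    Function.Injective (coeff : CrossedProduct f → Gal(K/F) → K) := fun _ _ h =>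
  CrossedProduct.ext h

@[simp] theorem coeff_zero (σ : Gal(K/F)) : (0 : CrossedProduct f).coeff σ = 0 := rfl
@[simp] theorem coeff_add (a b : CrossedProduct f) (σ : Gal(K/F)) :
    (a + b).coeff σ = a.coeff σ + b.coeff σ := rfl
@[simp] theorem coeff_smul {R : Type*} [SMul R K] (r : R) (a : CrossedProduct f) (σ : Gal(K/F)) :
    (r • a).coeff σ = r • a.coeff σ := rfl

instance : AddCommGroup (CrossedProduct f) :=
  coeff_injective.addCommGroup coeff rfl (fun _ _ => rfl) (fun _ => rfl) (fun _ _ => rfl)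
    (fun _ _ => rfl) (fun _ _ => rfl)

open scoped Classical in
/-- The identity `1 = x_1`. -/
noncomputable instance : One (CrossedProduct f) := ⟨⟨fun σ => if σ = 1 then 1 else 0⟩⟩

open scoped Classical in
theorem coeff_one (σ : Gal(K/F)) :
    (1 : CrossedProduct f).coeff σ = if σ = 1 then 1 else 0 := rfl

variable [FiniteDimensional F K]

/-- The multiplication determined by `x_σ s = σ(s) x_σ` and `x_σ x_τ = f(σ, τ) x_{στ}`:
the coefficient of `x_γ` in `a b` is the sum of `a_σ σ(b_τ) f(σ, τ)` over `σ τ = γ`. -/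
noncomputable instance : Mul (CrossedProduct f) :=
  ⟨fun a b => ⟨fun γ =>
    ∑ σ : Gal(K/F), a.coeff σ * σ (b.coeff (σ⁻¹ * γ)) * f.val σ (σ⁻¹ * γ)⟩⟩

theorem coeff_mul (a b : CrossedProduct f) (γ : Gal(K/F)) :
    (a * b).coeff γ =
      ∑ σ : Gal(K/F), a.coeff σ * σ (b.coeff (σ⁻¹ * γ)) * f.val σ (σ⁻¹ * γ) := rfl

protected theorem mul_assoc' (a b c : CrossedProduct f) : a * b * c = a * (b * c) := by
  ext γ
  simp only [coeff_mul, map_sum, map_mul, Finset.sum_mul, Finset.mul_sum]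
  rw [Finset.sum_comm]
  refine Finset.sum_congr rfl fun σ _ => ?_
  rw [← Equiv.sum_comp (Equiv.mulLeft σ)]
  refine Finset.sum_congr rfl fun τ _ => ?_
  have h := f.val_cocycle σ τ (τ⁻¹ * (σ⁻¹ * γ))
  simp only [Equiv.coe_mulLeft, mul_inv_rev, inv_mul_cancel_left, mul_assoc,
    mul_inv_cancel_left, AlgEquiv.mul_apply] at h ⊢
  linear_combination a.coeff σ * σ (b.coeff τ) * σ (τ (c.coeff (τ⁻¹ * (σ⁻¹ * γ)))) * h

noncomputable instance : Ring (CrossedProduct f) :=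
  { (inferInstance : AddCommGroup (CrossedProduct f)),
    (inferInstance : Mul (CrossedProduct f)),
    (inferInstance : One (CrossedProduct f)) with
    mul_assoc := CrossedProduct.mul_assoc'
    one_mul := fun a => by
      ext γ
      rw [coeff_mul, Finset.sum_eq_single 1]
      · simp [coeff_one, f.val_one_left]
      · intro σ _ h
        simp [coeff_one, h]
      · simp
    mul_one := fun a => by
      ext γ
      rw [coeff_mul, Finset.sum_eq_single γ]
      · simp [coeff_one, f.val_one_right]
      · intro σ _ h
        have : σ⁻¹ * γ ≠ 1 := fun h' => h (inv_mul_eq_one.mp h')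
        simp [coeff_one, this]
      · simp
    zero_mul := fun a => by ext γ; simp [coeff_mul]
    mul_zero := fun a => by ext γ; simp [coeff_mul]
    left_distrib := fun a b c => by
      ext γ; simp [coeff_mul, mul_add, add_mul, Finset.sum_add_distrib]
    right_distrib := fun a b c => by
      ext γ; simp [coeff_mul, add_mul, Finset.sum_add_distrib] }

/-- The structure of an algebra over `F`, and over any ring of scalars mapping to `F`;
scalars act on the coefficients. -/
noncomputable instance {R : Type*} [CommRing R] [Algebra R F] [Algebra R K]
    [IsScalarTower R F K] : Algebra R (CrossedProduct f) :=
  letI : Module R (CrossedProduct f) :=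
    coeff_injective.module R ⟨⟨coeff, rfl⟩, fun _ _ => rfl⟩ (fun _ _ => rfl)
  Algebra.ofModule
    (fun r a b => by
      ext γ; simp [coeff_mul, Finset.smul_sum])
    (fun r a b => by
      ext γ
      simp only [coeff_mul, coeff_smul, Finset.smul_sum]
      refine Finset.sum_congr rfl fun σ _ => ?_
      rw [← algebraMap_smul F r (b.coeff (σ⁻¹ * γ)), map_smul, algebraMap_smul]
      simp)

variable (V : Type*) [CommRing V] [Algebra V F] [Algebra V K] [IsScalarTower V F K]

/-- The crossed-product order `A_f = ∑_{σ ∈ G} S x_σ` inside `Σ_f`, where `S` is the integral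
closure of `V` in `K` and `f` takes its values in `S`. -/
noncomputable def order (f : NormalizedCocycle F K)
    (hf : ∀ σ τ : Gal(K/F), f.val σ τ ∈ integralClosure V K) :
    Subalgebra V (CrossedProduct f) where
  carrier := {a | ∀ σ, a.coeff σ ∈ integralClosure V K}
  mul_mem' := fun {a b} ha hb γ => by
    rw [coeff_mul]
    refine Subalgebra.sum_mem _ fun σ _ => Subalgebra.mul_mem _ (Subalgebra.mul_mem _ (ha σ) ?_)
      (hf _ _)
    have h : IsIntegral V (b.coeff (σ⁻¹ * γ)) := hb _
    exact h.map (σ.toAlgHom.restrictScalars V)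
  add_mem' := fun {a b} ha hb σ => Subalgebra.add_mem _ (ha σ) (hb σ)
  algebraMap_mem' := fun r σ => by
    rw [Algebra.algebraMap_eq_smul_one, coeff_smul, coeff_one]
    refine Subalgebra.smul_mem _ ?_ r
    split_ifs
    · exact Subalgebra.one_mem _
    · exact Subalgebra.zero_mem _

end CrossedProduct

/-- A `V`-order in the `F`-algebra `A`: a subring of `A` containing `V` which is a finitely
generated `V`-module and spans `A` over `F`. -/
def IsOrder (V F : Type*) {A : Type*} [CommRing V] [Field F] [Ring A] [Algebra V A] [Algebra F A]
    (B : Subalgebra V A) : Prop :=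
  Module.Finite V B ∧ Submodule.span F (B : Set A) = ⊤

/-- A maximal `V`-order in the `F`-algebra `A`: a `V`-order which is not properly contained in
another `V`-order. -/
def IsMaximalOrder (V F : Type*) {A : Type*} [CommRing V] [Field F] [Ring A] [Algebra V A]
    [Algebra F A] (B : Subalgebra V A) : Prop :=
  Maximal (IsOrder V F) B

/-- The decomposition group `D_M = {σ ∈ G | σ(M) = M}` of an ideal `M` of the integral closure
of `V` in `K`. -/
def decompositionGroup {V K : Type*} (F : Type*) [CommRing V] [Field F] [Field K] [Algebra F K]
    [Algebra V K] (M : Ideal (integralClosure V K)) : Subgroup Gal(K/F) :=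
  MulAction.stabilizer Gal(K/F) ((↑) '' (M : Set (integralClosure V K)) : Set K)

/-! ### Integral two-cocycles on the action groupoid of a finite group. -/

section SuperadditiveFamily

variable {G X : Type*} [Group G] [Fintype G] [MulAction G X] {w : X → G → G → ℤ}

/-! Write `w v σ τ` for the order of `f(σ, τ)` at a prime `v` of `S`. The cocycle identity for `f`
makes `w` a nonnegative two-cocycle on the action groupoid of `G` on the primes, an arrow `σ`
running from `σ⁻¹ • v` to `v`. Both conditions of the theorem concern `w` on pairs of inverse
arrows: values at most `1`, and value `0` on at least one arrow between any two primes of an orbit.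

If `A_f` is maximal: a family `n σ v ≥ 0` with `n σ v + n τ (σ⁻¹ • v) ≤ n (σ * τ) v + w v σ τ` and
`n 1 = 0` defines an order containing `A_f`, by allowing the coefficient of `x_σ` a pole of order at
most `n σ v` at `v` (`polarSubalgebra`). Maximality forces `n = 0`. A suitable `n` comes from
averaging: summing the cocycle identity over the last variable shows that `|G| w` is the coboundary
of a one-cochain. This cochain can be adjusted to a nonnegative `s` with the same coboundary, and `n
= ⌊s / |G|⌋` works. Its vanishing means `s < |G|`, which gives both conditions
(`exists_superadditive`).

Conversely, let `B` be an order containing `A_f`. As `S` is unramified, the separability idempotent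
projects `B` onto its homogeneous components inside `B` (`single_coeff_mem`). If `k x_σ` lies in `B`
and `k` has a pole at `v`, the second condition moves it to some `l x_δ` in `B` with `δ` in the
decomposition group and `l` still having a pole. The first condition keeps a pole in every power,
and the power by the order of `δ` gives a nonintegral element of `K` inside `B`, which is
impossible. -/

theorem sum_cocycle
    (hc : ∀ y σ τ γ, w y (σ * τ) γ + w y σ τ = w (σ⁻¹ • y) τ γ + w y σ (τ * γ)) (y : X) (σ τ : G) :
    ∑ γ, w y σ γ + ∑ γ, w (σ⁻¹ • y) τ γ = ∑ γ, w y (σ * τ) γ + Fintype.card G * w y σ τ := by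
  have h := Finset.sum_congr (rfl : (Finset.univ : Finset G) = _) fun γ _ => hc y σ τ γ
  have h' : ∑ γ, w y σ (τ * γ) = ∑ γ, w y σ γ :=
    Equiv.sum_comp (Equiv.mulLeft τ) (fun γ => w y σ γ)
  rw [Finset.sum_add_distrib, Finset.sum_add_distrib, h'] at h
  simp only [Finset.sum_const, Finset.card_univ, nsmul_eq_mul] at h
  linarith

/-- Given a nonnegative normalized integral two-cocycle on the action groupoid of a finite group,
there is a nonnegative family bounded by it, which detects whether the cocycle has values `≤ 1`
on pairs of inverse arrows and vanishes on some such pair between any two objects of an orbit. -/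
theorem exists_superadditive (hw : ∀ y σ τ, 0 ≤ w y σ τ) (hone : ∀ y τ, w y 1 τ = 0)
    (hc : ∀ y σ τ γ, w y (σ * τ) γ + w y σ τ = w (σ⁻¹ • y) τ γ + w y σ (τ * γ)) :
    ∃ n : G → X → ℤ, (∀ σ y, 0 ≤ n σ y) ∧ (∀ y, n 1 y = 0) ∧
      (∀ σ τ y, n σ y + n τ (σ⁻¹ • y) ≤ n (σ * τ) y + w y σ τ) ∧
      ((∀ σ y, n σ y = 0) → ∀ y, (∀ τ, w y τ τ⁻¹ ≤ 1) ∧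
        ∀ σ, ∃ d ∈ MulAction.stabilizer G y, w y (d * σ) (d * σ)⁻¹ = 0) := by
  classical
  set N : ℤ := (Fintype.card G : ℤ) with hN
  have hNpos : 0 < N := by simp [hN, Fintype.card_pos]
  let Φ : G → X → ℤ := fun σ y => ∑ γ, w y σ γ
  have hΦ : ∀ y σ τ, Φ σ y + Φ τ (σ⁻¹ • y) = Φ (σ * τ) y + N * w y σ τ := fun y σ τ =>
    sum_cocycle hc y σ τ
  have hΦ0 : ∀ σ y, 0 ≤ Φ σ y := fun σ y => Finset.sum_nonneg fun γ _ => hw y σ γ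
  have hΦ1 : ∀ y, Φ 1 y = 0 := fun y => Finset.sum_eq_zero fun γ _ => hone y γ
  -- `r` picks a base point in each orbit; `b y` below is an arrow from it to `y` with `Φ` minimal.
  let r : X → X := fun y => (Quotient.mk (MulAction.orbitRel G X) y).out
  have hr : ∀ (σ : G) y, r (σ • y) = r y := fun σ y => by
    have : (Quotient.mk (MulAction.orbitRel G X) (σ • y)) =
        Quotient.mk (MulAction.orbitRel G X) y :=
      Quotient.sound ⟨σ, rfl⟩
    simp only [r, this]
  have hex : ∀ y, ∃ b : G, b • r y = y ∧ ∀ σ : G, σ • r y = y → Φ b y ≤ Φ σ y := fun y => by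
    have h1 : (Finset.univ.filter fun σ : G => σ • r y = y).Nonempty := by
      have h2 : (MulAction.orbitRel G X) (r y) y := Quotient.mk_out (s := MulAction.orbitRel G X) y
      obtain ⟨σ, hσ⟩ := MulAction.orbitRel_apply.mp (Setoid.symm' _ h2)
      exact ⟨σ, by simpa using hσ⟩
    obtain ⟨b, hb, hmin⟩ := Finset.exists_min_image _ (fun σ => Φ σ y) h1
    exact ⟨b, by simpa using hb, fun σ hσ => hmin σ (by simpa using hσ)⟩
  choose b hb hmin using hex
  let h : X → ℤ := fun y => Φ (b y) y
  -- Adding the coboundary of `h` keeps the relation with `N * w`, and minimality of `b` makes `s`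
  -- nonnegative.
  let s : G → X → ℤ := fun σ y => Φ σ y + h (σ⁻¹ • y) - h y
  have hs0 : ∀ σ y, 0 ≤ s σ y := fun σ y => by
    have h1 : (σ * b (σ⁻¹ • y)) • r y = y := by
      rw [mul_smul, ← hr σ⁻¹ y, hb, smul_inv_smul]
    have h2 := hmin y _ h1
    have h3 := hΦ y σ (b (σ⁻¹ • y))
    have h4 := mul_nonneg hNpos.le (hw y σ (b (σ⁻¹ • y)))
    simp only [s, h]
    linarith
  have hs1 : ∀ y, s 1 y = 0 := fun y => by simp [s, hΦ1]
  have hs : ∀ y σ τ, s σ y + s τ (σ⁻¹ • y) = s (σ * τ) y + N * w y σ τ := fun y σ τ => by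
    have := hΦ y σ τ
    simp only [s, mul_inv_rev, mul_smul]
    linarith
  refine ⟨fun σ y => s σ y / N, fun σ y => Int.ediv_nonneg (hs0 σ y) hNpos.le,
    fun y => by simp [hs1], fun σ τ y => ?_, fun hn y => ?_⟩
  · dsimp only
    -- Superadditivity of the floor: `⌊a / N⌋ + ⌊c / N⌋ ≤ ⌊(a + c) / N⌋`.
    rw [← Int.add_mul_ediv_left (s (σ * τ) y) _ hNpos.ne', ← hs, Int.le_ediv_iff_mul_le hNpos, add_mul]
    exact add_le_add (Int.ediv_mul_le _ hNpos.ne') (Int.ediv_mul_le _ hNpos.ne')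
  have hsN : ∀ σ y, s σ y < N := fun σ y => by
    by_contra hlt
    have := (Int.le_ediv_iff_mul_le hNpos (a := 1)).mpr (by simpa using not_lt.mp hlt)
    have h2 := hn σ y
    simp only at h2
    omega
  refine ⟨fun τ => ?_, fun σ => ?_⟩
  -- `N * w y τ τ⁻¹` is a sum of two values of `s`, hence less than `2 * N`.
  · have h1 := hs y τ τ⁻¹
    rw [mul_inv_cancel, hs1] at h1
    have h2 := hsN τ y
    have h3 := hsN τ⁻¹ (τ⁻¹ • y)
    by_contra! hlt
    nlinarith
  · have hrr : ∀ y, r (r y) = r y := fun y => by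
      conv_rhs => rw [← hb y, hr]
    have hhr : ∀ y, h (r y) = 0 := fun y => by
      refine le_antisymm ?_ (hΦ0 _ _)
      have := hmin (r y) 1 (by rw [one_smul, hrr])
      rwa [hΦ1] at this
    have hbinv : ∀ y, (b y)⁻¹ • y = r y := fun y => by rw [inv_smul_eq_iff, hb]
    have hsb : ∀ y, s (b y) y = 0 := fun y => by simp [s, hbinv, hhr, h]
    -- `s` vanishes on `b y`, so its value on the inverse arrow is a multiple of `N`; being less
    -- than `N`, it is `0`.
    have hsb' : ∀ y, s (b y)⁻¹ (r y) = 0 := fun y => by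
      have h1 := hs (r y) (b y)⁻¹ (b y)
      rw [inv_inv, hb, hsb, inv_mul_cancel, hs1] at h1
      have h2 := hsN (b y)⁻¹ (r y)
      have h3 := hs0 (b y)⁻¹ (r y)
      have h4 : w (r y) (b y)⁻¹ (b y) < 1 := by
        by_contra! hlt
        nlinarith
      have h5 := hw (r y) (b y)⁻¹ (b y)
      have h6 : w (r y) (b y)⁻¹ (b y) = 0 := by omega
      rw [h6] at h1
      linarith
    have key : ∀ x y, r x = r y → s (b y * (b x)⁻¹) y = 0 := fun x y hxy => by
      have h1 := hs y (b y) (b x)⁻¹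
      rw [hsb, hbinv, ← hxy, hsb'] at h1
      have h2 := hs0 (b y * (b x)⁻¹) y
      have h3 := mul_nonneg hNpos.le (hw y (b y) (b x)⁻¹)
      linarith
    have hrx : r (σ⁻¹ • y) = r y := hr σ⁻¹ y
    -- With this `d`, `d * σ` is the arrow from `σ⁻¹ • y` to `y` through the base point; `s`
    -- vanishes on it and on its inverse.
    refine ⟨b y * (b (σ⁻¹ • y))⁻¹ * σ⁻¹, ?_, ?_⟩
    · rw [MulAction.mem_stabilizer_iff, mul_smul, mul_smul, hbinv, hrx, hb]
    · rw [inv_mul_cancel_right]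
      have h1 := hs y (b y * (b (σ⁻¹ • y))⁻¹) (b y * (b (σ⁻¹ • y))⁻¹)⁻¹
      rw [mul_inv_cancel, hs1, key _ _ hrx, mul_inv_rev, inv_inv, mul_smul, hbinv, ← hrx, hb,
        key _ _ hrx.symm] at h1
      simpa [hNpos.ne'] using h1.symm

end SuperadditiveFamily

/-! ### Galois action on primes and valuations. -/

namespace IsDedekindDomain.HeightOneSpectrum

variable {G R : Type*} [Group G] [CommRing R] [MulSemiringAction G R]

/-- The action of a group of automorphisms of a ring on its height one primes. -/
noncomputable instance : MulAction G (HeightOneSpectrum R) where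
  smul σ v := ⟨σ • v.asIdeal, v.isPrime.smul σ, fun h => v.ne_bot <| by
    rw [← inv_smul_smul σ v.asIdeal, h, Ideal.smul_bot]⟩
  one_smul v := HeightOneSpectrum.ext (one_smul G v.asIdeal)
  mul_smul σ τ v := HeightOneSpectrum.ext (mul_smul σ τ v.asIdeal)

theorem smul_asIdeal (σ : G) (v : HeightOneSpectrum R) : (σ • v).asIdeal = σ • v.asIdeal := rfl

variable [IsDedekindDomain R]

theorem intValuation_smul (σ : G) (v : HeightOneSpectrum R) (r : R) :
    (σ • v).intValuation (σ • r) = v.intValuation r := by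
  rcases eq_or_ne r 0 with rfl | hr
  · simp
  have key : ∀ n : ℕ, (σ • v).intValuation (σ • r) ≤ WithZero.exp (-(n : ℤ)) ↔
      v.intValuation r ≤ WithZero.exp (-(n : ℤ)) := fun n => by
    rw [intValuation_le_pow_iff_mem, intValuation_le_pow_iff_mem, smul_asIdeal, ← smul_pow',
      Ideal.smul_mem_pointwise_smul_iff]
  have hsr : σ • r ≠ 0 := (smul_ne_zero_iff_ne σ).mpr hr
  rw [intValuation_if_neg _ hsr, intValuation_if_neg _ hr] at key ⊢
  exact le_antisymm ((key _).mpr le_rfl) ((key _).mp le_rfl)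

variable {K : Type*} [Field K] [Algebra R K] [IsFractionRing R K] [MulSemiringAction G K]
  [SMulDistribClass G R K]

theorem valuation_smul (σ : G) (v : HeightOneSpectrum R) (x : K) :
    (σ • v).valuation K (σ • x) = v.valuation K x := by
  obtain ⟨a, d, -, rfl⟩ := IsFractionRing.div_surjective (A := R) x
  rw [smul_div₀', ← algebraMap.smul', ← algebraMap.smul', map_div₀, map_div₀]
  simp only [valuation_of_algebraMap, intValuation_smul]

theorem valuation_inv_smul (σ : G) (v : HeightOneSpectrum R) (x : K) :
    v.valuation K (σ • x) = (σ⁻¹ • v).valuation K x := by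
  rw [← valuation_smul σ (σ⁻¹ • v) x, smul_inv_smul]

/-- Any `x` in the inverse of `v` but outside `R` works: multiplying by a uniformizer at `v` bounds
the pole there, and multiplying by an element of `v` outside `u` excludes a pole at `u`. Such an `x`
shows that allowing one pole strictly enlarges `A_f`. -/
theorem exists_valuation_le_exp_one (v : HeightOneSpectrum R) :
    ∃ x : K, x ∉ (algebraMap R K).range ∧ v.valuation K x ≤ WithZero.exp 1 ∧
      ∀ u : HeightOneSpectrum R, u ≠ v → u.valuation K x ≤ 1 := by
  obtain ⟨x, hx, hx'⟩ := FractionalIdeal.exists_notMem_one_of_ne_bot (K := K) v.ne_bot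
    v.isPrime.ne_top
  have hmul : ∀ a ∈ v.asIdeal, ∃ r : R, algebraMap R K r = x * algebraMap R K a := fun a ha => by
    rw [FractionalIdeal.mem_inv_iff (by simpa using v.ne_bot)] at hx
    exact (FractionalIdeal.mem_one_iff _).mp (hx _ (FractionalIdeal.mem_coeIdeal_of_mem _ ha))
  refine ⟨x, fun ⟨r, hr⟩ => hx' ((FractionalIdeal.mem_one_iff _).mpr ⟨r, hr⟩), ?_, fun u hu => ?_⟩
  · obtain ⟨p, hp⟩ := v.intValuation_exists_uniformizer
    have hpm : p ∈ v.asIdeal := by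
      rw [← pow_one v.asIdeal, ← intValuation_le_pow_iff_mem, hp]
      simp
    obtain ⟨r, hr⟩ := hmul p hpm
    have h1 : v.valuation K (algebraMap R K r) ≤ 1 := v.valuation_le_one r
    rw [hr, map_mul, valuation_of_algebraMap, hp, WithZero.exp_neg,
      mul_inv_le_iff₀ (by simp)] at h1
    simpa using h1
  · obtain ⟨a, ha, hau⟩ : ∃ a ∈ v.asIdeal, a ∉ u.asIdeal := by
      by_contra! hle
      exact hu (HeightOneSpectrum.ext ((v.isMaximal.eq_of_le u.isPrime.ne_top hle).symm))
    obtain ⟨r, hr⟩ := hmul a ha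
    have h1 : u.valuation K (algebraMap R K r) ≤ 1 := u.valuation_le_one r
    rwa [hr, map_mul, (u.valuation_eq_one_iff_notMem (K := K)).mpr hau, mul_one] at h1

end IsDedekindDomain.HeightOneSpectrum

/-! ### Homogeneous elements and finiteness of orders. -/

namespace CrossedProduct

variable {F K : Type*} [Field F] [Field K] [Algebra F K] {f : NormalizedCocycle F K}

open scoped Classical in
/-- The element `k x_σ`. -/
noncomputable def single (f : NormalizedCocycle F K) (σ : Gal(K/F)) (k : K) : CrossedProduct f :=
  ⟨Pi.single σ k⟩

open scoped Classical in
theorem coeff_single (σ τ : Gal(K/F)) (k : K) :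
    (single f σ k).coeff τ = if τ = σ then k else 0 := by
  simp [single, Pi.single_apply]

theorem coeff_single_same (σ : Gal(K/F)) (k : K) : (single f σ k).coeff σ = k := by
  simp [coeff_single]

variable [FiniteDimensional F K]

theorem single_mul_coeff (σ γ : Gal(K/F)) (k : K) (b : CrossedProduct f) :
    (single f σ k * b).coeff γ = k * σ (b.coeff (σ⁻¹ * γ)) * f.val σ (σ⁻¹ * γ) := by
  rw [coeff_mul, Finset.sum_eq_single σ]
  · rw [coeff_single_same]
  · intro τ _ h
    simp [coeff_single, h]
  · simp

theorem mul_single_one_coeff (γ : Gal(K/F)) (k : K) (b : CrossedProduct f) :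
    (b * single f 1 k).coeff γ = b.coeff γ * γ k := by
  rw [coeff_mul, Finset.sum_eq_single γ]
  · simp [coeff_single, f.val_one_right]
  · intro τ _ h
    have : τ⁻¹ * γ ≠ 1 := fun h' => h (inv_mul_eq_one.mp h')
    simp [coeff_single, this]
  · simp

theorem single_mul_single (σ τ : Gal(K/F)) (k l : K) :
    single f σ k * single f τ l = single f (σ * τ) (k * σ l * f.val σ τ) := by
  ext γ
  rw [single_mul_coeff, coeff_single, coeff_single]
  by_cases h : γ = σ * τ
  · simp [h]
  · have : σ⁻¹ * γ ≠ τ := fun h' => h (by rw [← h', mul_inv_cancel_left])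
    simp [h, this]

theorem sum_single (b : CrossedProduct f) : ∑ σ, single f σ (b.coeff σ) = b := by
  classical
  have hsum : ∀ (s : Finset Gal(K/F)) (γ : Gal(K/F)),
      (∑ σ ∈ s, single f σ (b.coeff σ)).coeff γ = ∑ σ ∈ s, (single f σ (b.coeff σ)).coeff γ :=
    fun s γ => map_sum (⟨⟨fun a => a.coeff γ, rfl⟩, fun _ _ => rfl⟩ : CrossedProduct f →+ K) _ s
  ext γ
  rw [hsum]
  simp [coeff_single]

/-- The embedding of `K` as the coefficients of the identity. -/
noncomputable def singleOneAlgHom (V : Type*) [CommRing V] [Algebra V F] [Algebra V K]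
    [IsScalarTower V F K] (f : NormalizedCocycle F K) : K →ₐ[V] CrossedProduct f where
  toFun := single f 1
  map_one' := by ext γ; simp [coeff_single, coeff_one]
  map_mul' k l := by simp [single_mul_single, f.val_one_left]
  map_zero' := by ext γ; simp [coeff_single]
  map_add' k l := by
    ext γ
    simp only [coeff_single, coeff_add]
    split_ifs <;> simp
  commutes' r := by
    ext γ
    rw [Algebra.algebraMap_eq_smul_one (A := CrossedProduct f), coeff_smul, coeff_one,
      coeff_single]
    split_ifs <;> simp [Algebra.algebraMap_eq_smul_one]

section Order

variable {V : Type*} [CommRing V] [IsDomain V] [IsDiscreteValuationRing V] [Algebra V F]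
  [IsFractionRing V F] [IsGalois F K] [Algebra V K] [IsScalarTower V F K]

/-- Subalgebras whose coefficients have bounded denominators are finite. -/
theorem finite_of_mul_coeff_mem (B : Subalgebra V (CrossedProduct f)) (c : Gal(K/F) → K)
    (hc : ∀ σ, c σ ≠ 0) (hB : ∀ b ∈ B, ∀ σ, b.coeff σ * c σ ∈ integralClosure V K) :
    Module.Finite V B := by
  have : Module.Finite V (integralClosure V K) :=
    IsIntegralClosure.finite V F K (integralClosure V K)
  let g : B →ₗ[V] (Gal(K/F) → integralClosure V K) :=
    { toFun := fun b σ => ⟨b.1.coeff σ * c σ, hB _ b.2 σ⟩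
      map_add' := fun a b => by ext σ; simp [add_mul]
      map_smul' := fun r b => by ext σ; simp }
  refine Module.Finite.of_injective g fun a b hab => Subtype.ext (CrossedProduct.ext ?_)
  funext σ
  have h := congrArg (fun u => (u σ : K)) hab
  exact mul_right_cancel₀ (hc σ) h

theorem isOrder_order (hf : ∀ σ τ : Gal(K/F), f.val σ τ ∈ integralClosure V K) :
    IsOrder V F (order V f hf) := by
  refine ⟨finite_of_mul_coeff_mem _ (fun _ => 1) (fun _ => one_ne_zero)
    fun b hb σ => by simpa using hb σ, ?_⟩
  rw [eq_top_iff]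
  rintro b -
  rw [← sum_single b]
  refine Submodule.sum_mem _ fun σ _ => ?_
  -- Every element of `K` is an element of `S` over a denominator from `V`, so `F`-multiples of `S
  -- x_σ` exhaust `K x_σ`.
  have hloc : IsLocalization (Algebra.algebraMapSubmonoid (integralClosure V K)
      (nonZeroDivisors V)) K := IsIntegralClosure.isLocalization V F K _
  obtain ⟨a, ⟨_, d, hd, rfl⟩, had⟩ := IsLocalization.exists_mk'_eq
    (Algebra.algebraMapSubmonoid (integralClosure V K) (nonZeroDivisors V)) (b.coeff σ)
  have hd0 : algebraMap V F d ≠ 0 :=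
    IsFractionRing.to_map_ne_zero_of_mem_nonZeroDivisors hd
  rw [IsLocalization.mk'_eq_iff_eq_mul] at had
  have hs : single f σ (b.coeff σ) = (algebraMap V F d)⁻¹ • single f σ (a : K) := by
    ext γ
    rw [coeff_smul, coeff_single, coeff_single]
    split_ifs
    · rw [Algebra.smul_def, map_inv₀, ← IsScalarTower.algebraMap_apply, eq_inv_mul_iff_mul_eq₀,
        mul_comm]
      · exact had.symm
      · rw [IsScalarTower.algebraMap_apply V F K]
        simpa using hd0
    · simp
  rw [hs]
  refine Submodule.smul_mem _ _ (Submodule.subset_span fun γ => ?_)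
  rw [coeff_single]
  split_ifs
  · exact a.2
  · exact Subalgebra.zero_mem _

end Order

end CrossedProduct

/-! ### Orders of the cocycle values at the primes of `S`. -/

namespace CrossedProduct

open IsDedekindDomain HeightOneSpectrum

variable {F K : Type*} [Field F] [Field K] [Algebra F K] {f : NormalizedCocycle F K}

theorem val_ne_zero (f : NormalizedCocycle F K) (σ τ : Gal(K/F)) : f.val σ τ ≠ 0 :=
  Units.ne_zero _

variable {V : Type*} [CommRing V] [Algebra V K]

section OrdVal

variable [IsDedekindDomain (integralClosure V K)] [IsFractionRing (integralClosure V K) K]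

/-- The order of the value `f(σ, τ)` at a prime. -/
noncomputable def ordVal (f : NormalizedCocycle F K) (v : HeightOneSpectrum (integralClosure V K))
    (σ τ : Gal(K/F)) : ℤ :=
  -WithZero.log (v.valuation K (f.val σ τ))

theorem valuation_val (v : HeightOneSpectrum (integralClosure V K)) (σ τ : Gal(K/F)) :
    v.valuation K (f.val σ τ) = WithZero.exp (-ordVal f v σ τ) := by
  rw [ordVal, neg_neg, WithZero.exp_log]
  exact (Valuation.ne_zero_iff _).mpr (val_ne_zero f σ τ)

theorem ordVal_one_left (v : HeightOneSpectrum (integralClosure V K)) (τ : Gal(K/F)) :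
    ordVal f v 1 τ = 0 := by
  simp [ordVal, f.val_one_left]

theorem ordVal_one_right (v : HeightOneSpectrum (integralClosure V K)) (τ : Gal(K/F)) :
    ordVal f v τ 1 = 0 := by
  simp [ordVal, f.val_one_right]

theorem le_ordVal_iff (hf : ∀ σ τ : Gal(K/F), f.val σ τ ∈ integralClosure V K)
    (v : HeightOneSpectrum (integralClosure V K)) (σ τ : Gal(K/F)) (n : ℕ) :
    n ≤ ordVal f v σ τ ↔ (⟨f.val σ τ, hf σ τ⟩ : integralClosure V K) ∈ v.asIdeal ^ n := by
  rw [← intValuation_le_pow_iff_mem, ← valuation_of_algebraMap (K := K)]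
  change _ ↔ v.valuation K (f.val σ τ) ≤ _
  rw [valuation_val, WithZero.exp_le_exp, neg_le_neg_iff]

theorem ordVal_nonneg (hf : ∀ σ τ : Gal(K/F), f.val σ τ ∈ integralClosure V K)
    (v : HeightOneSpectrum (integralClosure V K)) (σ τ : Gal(K/F)) : 0 ≤ ordVal f v σ τ := by
  simpa using (le_ordVal_iff hf v σ τ 0).mpr (by simp)

end OrdVal

variable [Algebra V F] [IsScalarTower V F K]

instance : SMulCommClass Gal(K/F) V K where
  smul_comm σ r k := by
    rw [← algebraMap_smul F r, ← algebraMap_smul F r, smul_comm]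

section OrdVal

variable [IsDedekindDomain (integralClosure V K)] [IsFractionRing (integralClosure V K) K]

theorem valuation_apply (v : HeightOneSpectrum (integralClosure V K)) (σ : Gal(K/F)) (k : K) :
    v.valuation K (σ k) = (σ⁻¹ • v).valuation K k :=
  valuation_inv_smul σ v k

theorem ordVal_cocycle (v : HeightOneSpectrum (integralClosure V K)) (σ τ γ : Gal(K/F)) :
    ordVal f v (σ * τ) γ + ordVal f v σ τ =
      ordVal f (σ⁻¹ • v) τ γ + ordVal f v σ (τ * γ) := by
  have h := congrArg (v.valuation K) (f.val_cocycle σ τ γ)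
  rw [map_mul, map_mul, valuation_apply, valuation_val, valuation_val, valuation_val,
    valuation_val, ← WithZero.exp_add, ← WithZero.exp_add, WithZero.exp_inj] at h
  linarith

end OrdVal

/-! ### The separability idempotent and the grading. -/

section Unramified

open TensorProduct

variable [Algebra.FormallyUnramified V (integralClosure V K)]
  [Algebra.EssFiniteType V (integralClosure V K)]

theorem productMap_elem_one :
    Algebra.TensorProduct.productMap (integralClosure V K).val
      (((1 : Gal(K/F)).toAlgHom.restrictScalars V).comp (integralClosure V K).val)
      (Algebra.FormallyUnramified.elem V (integralClosure V K)) = 1 := by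
  have h : Algebra.TensorProduct.productMap (integralClosure V K).val
      (((1 : Gal(K/F)).toAlgHom.restrictScalars V).comp (integralClosure V K).val) =
      (integralClosure V K).val.comp (Algebra.TensorProduct.lmul' V) := by
    ext <;> simp
  rw [h, AlgHom.comp_apply, Algebra.FormallyUnramified.lmul_elem, map_one]

variable [IsFractionRing (integralClosure V K) K]

/-- The idempotent `e` satisfies `(1 ⊗ s) e = (s ⊗ 1) e`, so its image under `a ⊗ c ↦ a ρ(c)` is
killed by `ρ(s) - s` for all `s`. A nonzero image would make `ρ` trivial on `S`, hence on `K`. -/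
theorem productMap_elem_of_ne_one {ρ : Gal(K/F)} (hρ : ρ ≠ 1) :
    Algebra.TensorProduct.productMap (integralClosure V K).val
      ((ρ.toAlgHom.restrictScalars V).comp (integralClosure V K).val)
      (Algebra.FormallyUnramified.elem V (integralClosure V K)) = 0 := by
  by_contra h
  have hs : ∀ s : integralClosure V K, ρ s = s := fun s => by
    have h1 := congrArg (Algebra.TensorProduct.productMap (integralClosure V K).val
      ((ρ.toAlgHom.restrictScalars V).comp (integralClosure V K).val))
      (Algebra.FormallyUnramified.one_tmul_mul_elem (R := V) s)
    rw [map_mul, map_mul] at h1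
    simpa using mul_right_cancel₀ h h1
  refine hρ (AlgEquiv.ext fun k => ?_)
  obtain ⟨a, d, -, rfl⟩ := IsFractionRing.div_surjective (A := integralClosure V K) k
  rw [map_div₀, AlgEquiv.one_apply]
  exact congrArg₂ _ (hs a) (hs d)

end Unramified

variable [FiniteDimensional F K]

section Unramified

open TensorProduct

/-- `B` is an `S`-bimodule: the tensor `s ⊗ t` acts by `b ↦ s b σ⁻¹(t)`, which multiplies the
coefficient at `τ` by `s · τσ⁻¹(t)`. The twist by `σ⁻¹` makes the idempotent select the coefficient
at `σ`. -/
theorem exists_mem_coeff_eq_productMap_mul (hf : ∀ σ τ : Gal(K/F), f.val σ τ ∈ integralClosure V K)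
    {B : Subalgebra V (CrossedProduct f)} (hB : order V f hf ≤ B) {b : CrossedProduct f}
    (hb : b ∈ B) (σ : Gal(K/F)) (t : integralClosure V K ⊗[V] integralClosure V K) :
    ∃ c ∈ B, ∀ τ : Gal(K/F), c.coeff τ = Algebra.TensorProduct.productMap (integralClosure V K).val
      (((τ * σ⁻¹).toAlgHom.restrictScalars V).comp (integralClosure V K).val) t * b.coeff τ := by
  have hsingle : ∀ s : K, s ∈ integralClosure V K → single f 1 s ∈ B := fun s hs =>
    hB fun γ => by
      rw [coeff_single]
      split_ifs
      · exact hs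
      · exact Subalgebra.zero_mem _
  induction t with
  | zero => exact ⟨0, B.zero_mem, fun τ => by simp⟩
  | tmul s t =>
    have ht : σ⁻¹ (t : K) ∈ integralClosure V K := by
      have h : IsIntegral V (t : K) := t.2
      exact h.map (σ⁻¹.toAlgHom.restrictScalars V)
    refine ⟨single f 1 s * b * single f 1 (σ⁻¹ t),
      B.mul_mem (B.mul_mem (hsingle _ s.2) hb) (hsingle _ ht), fun τ => ?_⟩
    rw [mul_single_one_coeff, single_mul_coeff]
    simp [f.val_one_left]
    ring
  | add t u ht hu =>
    obtain ⟨c, hc, hc'⟩ := ht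
    obtain ⟨d, hd, hd'⟩ := hu
    exact ⟨c + d, B.add_mem hc hd, fun τ => by rw [coeff_add, hc', hd', map_add, add_mul]⟩

variable [Algebra.FormallyUnramified V (integralClosure V K)]
  [Algebra.EssFiniteType V (integralClosure V K)] [IsFractionRing (integralClosure V K) K]

/-- Over an unramified extension, a subalgebra that contains the crossed-product order
is graded. -/
theorem single_coeff_mem (hf : ∀ σ τ : Gal(K/F), f.val σ τ ∈ integralClosure V K)
    {B : Subalgebra V (CrossedProduct f)} (hB : order V f hf ≤ B) {b : CrossedProduct f}
    (hb : b ∈ B) (σ : Gal(K/F)) : single f σ (b.coeff σ) ∈ B := by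
  obtain ⟨c, hc, hc'⟩ := exists_mem_coeff_eq_productMap_mul hf hB hb σ
    (Algebra.FormallyUnramified.elem V (integralClosure V K))
  convert hc
  ext τ
  rw [hc', coeff_single]
  split_ifs with h
  · subst h
    rw [mul_inv_cancel, productMap_elem_one, one_mul]
  · rw [productMap_elem_of_ne_one (mul_inv_eq_one.not.mpr h), zero_mul]

end Unramified

theorem mem_integralClosure_of_single_one_mem {B : Subalgebra V (CrossedProduct f)}
    [Module.Finite V B] {k : K} (hk : single f 1 k ∈ B) : k ∈ integralClosure V K := by
  have h1 : IsIntegral V (⟨single f 1 k, hk⟩ : B) := IsIntegral.of_finite V _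
  have h2 : IsIntegral V (singleOneAlgHom V f k) := h1.map B.val
  refine (isIntegral_algHom_iff _ fun k l hkl => ?_).mp h2
  have h3 : single f 1 k = single f 1 l := hkl
  rw [← coeff_single_same (f := f) 1 k, h3, coeff_single_same]

variable [IsDedekindDomain (integralClosure V K)] [IsFractionRing (integralClosure V K) K]

/-- The elements whose coefficient at `σ` has a pole of order at most `n σ v` at each `v`. -/
noncomputable def polarSubalgebra (hf : ∀ σ τ : Gal(K/F), f.val σ τ ∈ integralClosure V K)
    (n : Gal(K/F) → HeightOneSpectrum (integralClosure V K) → ℤ) (hn : ∀ σ v, 0 ≤ n σ v)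
    (hmul : ∀ σ τ v, n σ v + n τ (σ⁻¹ • v) ≤ n (σ * τ) v + ordVal f v σ τ) :
    Subalgebra V (CrossedProduct f) where
  carrier := {a | ∀ σ (v : HeightOneSpectrum (integralClosure V K)),
    v.valuation K (a.coeff σ) ≤ WithZero.exp (n σ v)}
  mul_mem' := fun {a b} ha hb γ v => by
    rw [coeff_mul]
    refine Valuation.map_sum_le _ fun σ _ => ?_
    rw [map_mul, map_mul, valuation_apply, valuation_val]
    refine (mul_le_mul' (mul_le_mul' (ha σ v) (hb _ _)) le_rfl).trans ?_
    rw [← WithZero.exp_add, ← WithZero.exp_add, WithZero.exp_le_exp]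
    have := hmul σ (σ⁻¹ * γ) v
    rw [mul_inv_cancel_left] at this
    linarith
  add_mem' := fun {a b} ha hb σ v => Valuation.map_add_le _ (ha σ v) (hb σ v)
  algebraMap_mem' := fun r σ v => by
    refine ((v.valuation_le_one (K := K)
      ⟨_, (order V f hf).algebraMap_mem r σ⟩).trans ?_)
    rw [← WithZero.exp_zero, WithZero.exp_le_exp]
    exact hn σ v

theorem order_le_polarSubalgebra (hf : ∀ σ τ : Gal(K/F), f.val σ τ ∈ integralClosure V K)
    (n : Gal(K/F) → HeightOneSpectrum (integralClosure V K) → ℤ) (hn : ∀ σ v, 0 ≤ n σ v)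
    (hmul : ∀ σ τ v, n σ v + n τ (σ⁻¹ • v) ≤ n (σ * τ) v + ordVal f v σ τ) :
    order V f hf ≤ polarSubalgebra hf n hn hmul := fun a ha σ v => by
  refine ((v.valuation_le_one (K := K) ⟨_, ha σ⟩).trans ?_)
  rw [← WithZero.exp_zero, WithZero.exp_le_exp]
  exact hn σ v

theorem mem_integralClosure_of_valuation_le_one {k : K}
    (hk : ∀ v : HeightOneSpectrum (integralClosure V K), v.valuation K k ≤ 1) :
    k ∈ integralClosure V K := by
  obtain ⟨a, rfl⟩ := mem_integers_of_valuation_le_one K k hk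
  exact a.2

/-! ### The two implications in terms of orders at primes. -/

variable [IsDomain V] [IsDiscreteValuationRing V] [IsFractionRing V F] [IsGalois F K]

theorem ordVal_of_isMaximalOrder (hf : ∀ σ τ : Gal(K/F), f.val σ τ ∈ integralClosure V K)
    (hmax : IsMaximalOrder V F (order V f hf)) (v : HeightOneSpectrum (integralClosure V K)) :
    (∀ τ, ordVal f v τ τ⁻¹ ≤ 1) ∧
      ∀ σ, ∃ d ∈ MulAction.stabilizer Gal(K/F) v, ordVal f v (d * σ) (d * σ)⁻¹ = 0 := by
  obtain ⟨n, hn, hn1, hmul, hzero⟩ := exists_superadditive (w := ordVal f)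
    (fun v : HeightOneSpectrum (integralClosure V K) => ordVal_nonneg hf v) ordVal_one_left
    ordVal_cocycle
  refine hzero (fun σ u => ?_) v
  set B := polarSubalgebra hf n hn hmul
  have hle : order V f hf ≤ B := order_le_polarSubalgebra hf n hn hmul
  have hB : IsOrder V F B := by
    -- The inequality for the pair `σ, σ⁻¹`, with `n 1 = 0`, gives `n σ v ≤ ordVal f v σ σ⁻¹`, so
    -- `f(σ, σ⁻¹)` is a common denominator.
    refine ⟨finite_of_mul_coeff_mem B (fun σ => f.val σ σ⁻¹) (fun σ => val_ne_zero f _ _)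
      fun b hb σ => mem_integralClosure_of_valuation_le_one fun v => ?_, ?_⟩
    · rw [map_mul, valuation_val]
      refine (mul_le_mul' (hb σ v) le_rfl).trans ?_
      rw [← WithZero.exp_add, ← WithZero.exp_zero, WithZero.exp_le_exp]
      have h1 := hmul σ σ⁻¹ v
      have h2 := hn σ⁻¹ (σ⁻¹ • v)
      rw [mul_inv_cancel, hn1] at h1
      linarith
    · exact top_le_iff.mp ((isOrder_order hf).2.symm.le.trans (Submodule.span_mono hle))
  by_contra hne
  have hpos : 1 ≤ n σ u := by
    have := hn σ u
    omega
  obtain ⟨x, hx, hxu, hxv⟩ := u.exists_valuation_le_exp_one (K := K)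
  have hxB : single f σ x ∈ B := fun γ v => by
    rw [coeff_single]
    split_ifs with h
    · subst h
      by_cases hv : v = u
      · subst hv
        exact hxu.trans (WithZero.exp_le_exp.mpr hpos)
      · exact (hxv v hv).trans (by rw [← WithZero.exp_zero, WithZero.exp_le_exp]; exact hn _ _)
    · simp
  have hxA : x ∈ integralClosure V K := by
    simpa [coeff_single_same] using hmax.2 hB hle hxB σ
  exact hx ⟨⟨x, hxA⟩, rfl⟩

theorem isMaximalOrder_of_ordVal [Algebra.FormallyUnramified V (integralClosure V K)]
    (hf : ∀ σ τ : Gal(K/F), f.val σ τ ∈ integralClosure V K)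
    (h1 : ∀ (v : HeightOneSpectrum (integralClosure V K)) τ, ordVal f v τ τ⁻¹ ≤ 1)
    (h2 : ∀ (v : HeightOneSpectrum (integralClosure V K)) σ,
      ∃ d ∈ MulAction.stabilizer Gal(K/F) v, ordVal f v (d * σ) (d * σ)⁻¹ = 0) :
    IsMaximalOrder V F (order V f hf) := by
  have : Module.Finite V (integralClosure V K) :=
    IsIntegralClosure.finite V F K (integralClosure V K)
  refine ⟨isOrder_order hf, fun B hB hle b hb σ => ?_⟩
  have := hB.1
  by_contra hk
  obtain ⟨v, hv⟩ : ∃ v : HeightOneSpectrum (integralClosure V K),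
      1 < v.valuation K (b.coeff σ) := by
    by_contra! h
    exact hk (mem_integralClosure_of_valuation_le_one h)
  have hkB := single_coeff_mem hf hle hb σ
  obtain ⟨d, hd, hdσ⟩ := h2 v σ
  have hd' : d • v = v := hd
  have hpow : ∀ j : ℕ, (d⁻¹ ^ j)⁻¹ • v = v := fun j =>
    inv_mem (pow_mem (inv_mem hd) j)
  -- Multiplication by `x_{(dσ)⁻¹}` lands in degree `d⁻¹`; the factor `f(σ, (dσ)⁻¹)` is a unit at
  -- `v`, so the pole survives unchanged.
  have hstart : ∃ l, single f d⁻¹ l ∈ B ∧ 1 < v.valuation K l := by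
    have hg : single f (d * σ)⁻¹ 1 ∈ B := hle fun γ => by
      rw [coeff_single]
      split_ifs
      · exact Subalgebra.one_mem _
      · exact Subalgebra.zero_mem _
    have hw : ordVal f v σ (d * σ)⁻¹ = 0 := by
      have h := ordVal_cocycle (f := f) v d⁻¹ (d * σ) (d * σ)⁻¹
      rw [inv_inv, hd', hdσ, mul_inv_cancel, ordVal_one_right, inv_mul_cancel_left] at h
      have h3 := ordVal_nonneg hf v σ (d * σ)⁻¹
      have h4 := ordVal_nonneg hf v d⁻¹ (d * σ)
      linarith
    have h := B.mul_mem hkB hg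
    rw [single_mul_single, mul_inv_rev, mul_inv_cancel_left, map_one, mul_one,
      ← mul_inv_rev] at h
    refine ⟨_, h, ?_⟩
    rwa [map_mul, valuation_val, hw, neg_zero, WithZero.exp_zero, mul_one]
  obtain ⟨l, hl, hvl⟩ := hstart
  have hlog : ∀ k : K, 1 < v.valuation K k ↔ WithZero.exp 1 ≤ v.valuation K k := fun k => by
    refine ⟨fun h => ?_, fun h => lt_of_lt_of_le ?_ h⟩
    · have h0 : v.valuation K k ≠ 0 := (zero_lt_one.trans h).ne'
      rw [← WithZero.le_log_iff_exp_le h0]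
      rw [← WithZero.exp_zero, ← WithZero.lt_log_iff_exp_lt h0] at h
      omega
    · rw [← WithZero.exp_zero, WithZero.exp_lt_exp]
      exact zero_lt_one
  -- Since `d` fixes `v`, each factor has a pole of order at least `1` at `v`, and the cocycle value
  -- cancels at most one of the two.
  have hiter : ∀ j : ℕ, ∃ m, single f (d⁻¹ ^ (j + 1)) m ∈ B ∧ 1 < v.valuation K m := fun j => by
    induction j with
    | zero => exact ⟨l, by simpa using hl, hvl⟩
    | succ j ih =>
      obtain ⟨m, hm, hvm⟩ := ih
      have h := B.mul_mem hm hl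
      rw [single_mul_single, ← pow_succ] at h
      refine ⟨_, h, ?_⟩
      have hw : ordVal f v (d⁻¹ ^ (j + 1)) d⁻¹ ≤ 1 := by
        have h := ordVal_cocycle (f := f) v (d⁻¹ ^ (j + 1)) d⁻¹ d⁻¹⁻¹
        rw [hpow, mul_inv_cancel, ordVal_one_right] at h
        have h3 := h1 v d⁻¹
        have h4 := ordVal_nonneg hf v (d⁻¹ ^ (j + 1) * d⁻¹) d⁻¹⁻¹
        linarith
      rw [hlog] at hvm ⊢
      rw [map_mul, map_mul, valuation_apply, hpow, valuation_val]
      refine le_trans ?_ (mul_le_mul' (mul_le_mul' hvm ((hlog l).mp hvl)) le_rfl)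
      rw [← WithZero.exp_add, ← WithZero.exp_add, WithZero.exp_le_exp]
      linarith
  obtain ⟨m, hm, hvm⟩ := hiter (orderOf d⁻¹ - 1)
  rw [Nat.sub_add_cancel (orderOf_pos _), pow_orderOf_eq_one] at hm
  have hmS := mem_integralClosure_of_single_one_mem hm
  exact hvm.not_ge (v.valuation_le_one (K := K) ⟨m, hmS⟩)

end CrossedProduct

/-! ### Right coset representatives. -/

section Transversal

variable {G : Type*} [Group G]

theorem Subgroup.exists_isComplement_of_forall_exists_mul (D : Subgroup G) {p : G → Prop}
    (h : ∀ σ, ∃ d ∈ D, p (d * σ)) :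
    ∃ T : Set G, Subgroup.IsComplement (D : Set G) T ∧ ∀ g ∈ T, p g := by
  choose d hd hp using h
  refine ⟨Set.range fun q : Quotient (QuotientGroup.rightRel D) => d q.out * q.out,
    Subgroup.isComplement_range_right fun q => ?_, ?_⟩
  · refine Eq.trans (Quotient.sound' ?_) q.out_eq'
    rw [QuotientGroup.rightRel_apply]
    simpa using hd q.out
  · rintro _ ⟨q, rfl⟩
    exact hp _

theorem Subgroup.IsComplement.exists_mul_mem {D : Subgroup G} {T : Set G}
    (h : Subgroup.IsComplement (D : Set G) T) (σ : G) : ∃ d ∈ D, d * σ ∈ T := by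
  obtain ⟨⟨⟨d, hd⟩, ⟨t, ht⟩⟩, rfl⟩ := h.2 σ
  exact ⟨d⁻¹, D.inv_mem hd, by simpa using ht⟩

end Transversal

/-! ### Translation into maximal ideals and decomposition groups. -/

namespace CrossedProduct

open IsDedekindDomain HeightOneSpectrum

variable {F K : Type*} [Field F] [Field K] [Algebra F K]
  {f : NormalizedCocycle F K} {V : Type*} [CommRing V] [Algebra V F] [Algebra V K]
  [IsScalarTower V F K]

theorem decompositionGroup_asIdeal (v : HeightOneSpectrum (integralClosure V K)) :
    decompositionGroup F v.asIdeal = MulAction.stabilizer Gal(K/F) v := by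
  ext σ
  have himage : σ • ((↑) '' (v.asIdeal : Set (integralClosure V K)) : Set K) =
      (↑) '' ((σ • v.asIdeal : Ideal (integralClosure V K)) : Set (integralClosure V K)) := by
    ext x
    constructor
    · rintro ⟨_, ⟨a, ha, rfl⟩, rfl⟩
      exact ⟨σ • a, Ideal.smul_mem_pointwise_smul σ a _ ha, rfl⟩
    · rintro ⟨a, ha, rfl⟩
      refine ⟨_, ⟨σ⁻¹ • a, Ideal.mem_pointwise_smul_iff_inv_smul_mem.mp ha, rfl⟩, ?_⟩
      exact smul_inv_smul σ (a : K)
  rw [decompositionGroup, MulAction.mem_stabilizer_iff, MulAction.mem_stabilizer_iff, himage,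
    Subtype.val_injective.image_injective.eq_iff, SetLike.coe_set_eq, HeightOneSpectrum.ext_iff,
    smul_asIdeal]

variable [FiniteDimensional F K] [IsDomain V] [IsDiscreteValuationRing V] [IsFractionRing V F]
  [IsGalois F K]

theorem isMaximalOrder_order_iff [Algebra.FormallyUnramified V (integralClosure V K)]
    (hf : ∀ σ τ : Gal(K/F), f.val σ τ ∈ integralClosure V K) :
    IsMaximalOrder V F (order V f hf) ↔
      ∀ M : Ideal (integralClosure V K), M.IsMaximal →
        (∀ τ : Gal(K/F), (⟨f.val τ τ⁻¹, hf τ τ⁻¹⟩ : integralClosure V K) ∉ M ^ 2) ∧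
        ∃ T : Set Gal(K/F),
          Subgroup.IsComplement (decompositionGroup F M : Set Gal(K/F)) T ∧
          ∀ g ∈ T, (⟨f.val g g⁻¹, hf g g⁻¹⟩ : integralClosure V K) ∉ M := by
  have : IsDedekindDomain (integralClosure V K) := integralClosure.isDedekindDomain V F K
  have : IsFractionRing (integralClosure V K) K :=
    integralClosure.isFractionRing_of_finite_extension F K
  have hsq : ∀ (v : HeightOneSpectrum (integralClosure V K)) σ τ, ordVal f v σ τ ≤ 1 ↔
      (⟨f.val σ τ, hf σ τ⟩ : integralClosure V K) ∉ v.asIdeal ^ 2 := fun v σ τ => by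
    rw [← le_ordVal_iff hf]
    push_cast
    omega
  have hzero : ∀ (v : HeightOneSpectrum (integralClosure V K)) σ τ, ordVal f v σ τ = 0 ↔
      (⟨f.val σ τ, hf σ τ⟩ : integralClosure V K) ∉ v.asIdeal := fun v σ τ => by
    have h1 := le_ordVal_iff hf v σ τ 1
    rw [pow_one] at h1
    rw [← h1]
    have := ordVal_nonneg hf v σ τ
    push_cast
    omega
  refine ⟨fun hmax M hM => ?_, fun h => isMaximalOrder_of_ordVal hf (fun v τ => ?_) fun v σ => ?_⟩
  -- If `M` were zero, its contraction `⊥` would be maximal in `V`, making `V` a field.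
  · have hbot : M ≠ ⊥ := by
      rintro rfl
      have h1 : (⊥ : Ideal (integralClosure V K)).under V = ⊥ := by
        rw [Ideal.under_def, ← RingHom.ker_eq_comap_bot, RingHom.ker_eq_bot_iff_eq_zero]
        intro r hr
        have h2 : algebraMap V K r = 0 := congrArg Subtype.val hr
        rw [IsScalarTower.algebraMap_apply V F K, map_eq_zero] at h2
        exact (IsFractionRing.to_map_eq_zero_iff (K := F)).mp h2
      have h2 : (⊥ : Ideal V).IsMaximal := h1 ▸ Ideal.isMaximal_comap_of_isIntegral_of_isMaximal _
      exact IsDiscreteValuationRing.not_isField V (Ring.isField_iff_maximal_bot.mpr h2)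
    let v : HeightOneSpectrum (integralClosure V K) := ⟨M, hM.isPrime, hbot⟩
    obtain ⟨h1, h2⟩ := ordVal_of_isMaximalOrder hf hmax v
    refine ⟨fun τ => (hsq v _ _).mp (h1 τ), ?_⟩
    refine Subgroup.exists_isComplement_of_forall_exists_mul _ fun σ => ?_
    obtain ⟨d, hd, hw⟩ := h2 σ
    exact ⟨d, (decompositionGroup_asIdeal (F := F) v).symm ▸ hd, (hzero v _ _).mp hw⟩
  · exact (hsq v _ _).mpr ((h v.asIdeal v.isMaximal).1 τ)
  · obtain ⟨T, hT, hg⟩ := (h v.asIdeal v.isMaximal).2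
    obtain ⟨d, hd, hdT⟩ := hT.exists_mul_mem σ
    exact ⟨d, decompositionGroup_asIdeal (F := F) v ▸ hd, (hzero v _ _).mpr (hg _ hdT)⟩

end CrossedProduct

theorem corollary2 {V F K : Type*} [CommRing V] [IsDomain V] [IsDiscreteValuationRing V]
    [Field F] [Algebra V F] [IsFractionRing V F]
    [Field K] [Algebra F K] [FiniteDimensional F K] [IsGalois F K]
    [Algebra V K] [IsScalarTower V F K]
    [Algebra.FormallyUnramified V (integralClosure V K)]
    (f : NormalizedCocycle F K)
    (hf : ∀ σ τ : Gal(K/F), f.val σ τ ∈ integralClosure V K) :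
    (IsMaximalOrder V F (CrossedProduct.order V f hf) ↔
      ∀ M : Ideal (integralClosure V K), M.IsMaximal →
        (∀ τ : Gal(K/F), (⟨f.val τ τ⁻¹, hf τ τ⁻¹⟩ : integralClosure V K) ∉ M ^ 2) ∧
        ∃ T : Set Gal(K/F),
          Subgroup.IsComplement (decompositionGroup F M : Set Gal(K/F)) T ∧
          ∀ g ∈ T, (⟨f.val g g⁻¹, hf g g⁻¹⟩ : integralClosure V K) ∉ M) ∧
    (IsDiscreteValuationRing (integralClosure V K) →
      (IsMaximalOrder V F (CrossedProduct.order V f hf) ↔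
        ∀ τ : Gal(K/F), (⟨f.val τ τ⁻¹, hf τ τ⁻¹⟩ : integralClosure V K) ∉
          Ring.jacobson (integralClosure V K) ^ 2)) := by
  refine ⟨CrossedProduct.isMaximalOrder_order_iff hf, fun hS => ?_⟩
  have hJ : Ring.jacobson (integralClosure V K) =
      IsLocalRing.maximalIdeal (integralClosure V K) := IsLocalRing.ringJacobson_eq_maximalIdeal _
  rw [CrossedProduct.isMaximalOrder_order_iff hf, hJ]
  refine ⟨fun h => (h _ (IsLocalRing.maximalIdeal.isMaximal _)).1, fun h M hM => ?_⟩
  obtain rfl := IsLocalRing.eq_maximalIdeal hM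
  -- The unique maximal ideal is fixed by all of `G`, so every coset representative can be taken to
  -- be `1`, where `f(1, 1) = 1`.
  refine ⟨h, Subgroup.exists_isComplement_of_forall_exists_mul _ fun σ => ⟨σ⁻¹, ?_, ?_⟩⟩
  · let v : IsDedekindDomain.HeightOneSpectrum (integralClosure V K) :=
      ⟨_, hM.isPrime, IsDiscreteValuationRing.not_a_field _⟩
    change σ⁻¹ ∈ decompositionGroup F v.asIdeal
    rw [CrossedProduct.decompositionGroup_asIdeal]
    refine IsDedekindDomain.HeightOneSpectrum.ext (IsLocalRing.eq_maximalIdeal ?_)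
    exact (σ⁻¹ • v).isMaximal
  · have h1 : (⟨f.val (σ⁻¹ * σ) (σ⁻¹ * σ)⁻¹, hf _ _⟩ : integralClosure V K) = 1 :=
      Subtype.ext (by simp [f.val_one_left])
    rw [h1]
    exact fun h => hM.ne_top ((Ideal.eq_top_iff_one _).mpr h)
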